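/- Let $G$ be the Heisenberg group, i.e. $\mathbb R^3$ with the product $(x,y,z)\star(x',y',z')=(x+x',\,y+y',\,z+z'+xy')$, let $\Gamma\subset G$ be the lattice of points with integer coordinates, and let $M=\Gamma\backslash G$. Let $L$ be the Lagrangian on $M$ induced by the left-invariant Lagrangian $$L=\tfrac12\big(\dot x^2+\dot y^2+(\dot z-x\dot y)^2\big)+\dot z-x\dot y$$ on $G$. For a cover $\widehat M$ of $M$ (with $L$ lifted to $\widehat M$) put $$c(\widehat M)=\inf\Big\{k\in\mathbb R:\ \int_0^T (L+k)(\gamma,\dot\gamma)\,dt\ge 0\ \text{ for every } T>0 \text{ and every absolutely continuous loop } \gamma:[0,T]\to\widehat M\Big\},$$ and let $c_u=c(G)$ be the value for the universal cover $G=\mathbb R^3$ and $c_a=c([\Gamma,\Gamma]\backslash G)$ the value for the abelian cover, whose group of deck transformations is $H_1(M;\mathbb Z)$. For $p,q\in G$ and $T>0$ let $h^T(p,q)$ be the infimum of $\int_0^T L(\gamma,\dot\gamma)\,dt$ over all absolutely continuous curves $\gamma:[0,T]\to G$ with $\gamma(0)=p$ and $\gamma(T)=q$, and let $$h(p,q)=\liminf_{T\to+\infty}\big(h^T(p,q)+c_uT\big)\in[-\infty,+\infty]$$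 be the Peierls barrier of the universal cover. (Integrals take the value $+\infty$ where the integrand, which is bounded below, is not integrable.) Then $c_u=c_a=\tfrac12$, and $h(p,p)=2\pi$ for every $p\in\mathbb R^3$. Moreover $h(p,q)$ is finite for all $p,q\in\mathbb R^3$, while the projected Aubry set $\{p\in\mathbb R^3: h(p,p)=0\}$ of the universal cover is empty. -/

import Mathlib

open Set Filter MeasureTheory
open scoped ENNReal

namespace HeisenbergExample

/-- The `3`-dimensional Heisenberg group, in the global coordinates `(x, y, z) ∈ ℝ³` of the
unipotent matrix with rows `(1, x, z)`, `(0, 1, y)`, `(0, 0, 1)`. -/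
@[ext]
structure Heis where
  x : ℝ
  y : ℝ
  z : ℝ

namespace Heis

/-- The matrix product in coordinates:
`(x, y, z) ⋆ (x', y', z') = (x + x', y + y', z + z' + x y')`. -/
instance : Mul Heis := ⟨fun p q => ⟨p.x + q.x, p.y + q.y, p.z + q.z + p.x * q.y⟩⟩

instance : One Heis := ⟨⟨0, 0, 0⟩⟩

instance : Inv Heis := ⟨fun p => ⟨-p.x, -p.y, -p.z + p.x * p.y⟩⟩

@[simp] theorem mul_x (p q : Heis) : (p * q).x = p.x + q.x := rfl
@[simp] theorem mul_y (p q : Heis) : (p * q).y = p.y + q.y := rfl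
@[simp] theorem mul_z (p q : Heis) : (p * q).z = p.z + q.z + p.x * q.y := rfl
@[simp] theorem one_x : (1 : Heis).x = 0 := rfl
@[simp] theorem one_y : (1 : Heis).y = 0 := rfl
@[simp] theorem one_z : (1 : Heis).z = 0 := rfl
@[simp] theorem inv_x (p : Heis) : (p⁻¹).x = -p.x := rfl
@[simp] theorem inv_y (p : Heis) : (p⁻¹).y = -p.y := rfl
@[simp] theorem inv_z (p : Heis) : (p⁻¹).z = -p.z + p.x * p.y := rfl

instance : Group Heis :=
  Group.ofLeftAxioms
    (fun p q r => by ext <;> simp <;> ring)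
    (fun p => by ext <;> simp)
    (fun p => by ext <;> simp)

/-- The coordinates are those of the matrix group. -/
def toMatrix (p : Heis) : Matrix (Fin 3) (Fin 3) ℝ := !![1, p.x, p.z; 0, 1, p.y; 0, 0, 1]

theorem toMatrix_mul (p q : Heis) : (p * q).toMatrix = p.toMatrix * q.toMatrix := by
  ext i j
  fin_cases i <;> fin_cases j <;>
    simp [toMatrix, Matrix.mul_apply, Fin.sum_univ_three] <;> ring

end Heis

/-- The lattice `Γ` of the elements with integer coordinates; the nilmanifold is `M = Γ \ G`. -/
def lattice : Subgroup Heis where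
  carrier := {p | ∃ a b c : ℤ, p = ⟨a, b, c⟩}
  mul_mem' := by
    rintro _ _ ⟨a, b, c, rfl⟩ ⟨a', b', c', rfl⟩
    exact ⟨a + a', b + b', c + c' + a * b', by ext <;> simp⟩
  one_mem' := ⟨0, 0, 0, by ext <;> simp⟩
  inv_mem' := by
    rintro _ ⟨a, b, c, rfl⟩
    exact ⟨-a, -b, -c + a * b, by ext <;> simp⟩

/-- The left quotient `Δ \ G`. For a subgroup `Δ` of `Γ` this is the cover of `M = Γ \ G` with
fundamental group `Δ`; every connected cover of `M` arises in this way. -/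
abbrev Cover (Δ : Subgroup Heis) : Type := MulAction.orbitRel.Quotient Δ Heis

/-- The covering projection `G → Δ \ G`. -/
def proj (Δ : Subgroup Heis) (p : Heis) : Cover Δ := Quotient.mk _ p

/-- The Lagrangian `L = ½ (ẋ² + ẏ² + (ż - x ẏ)²) + ż - x ẏ` at the point `p` and the
tangent vector `v = (ẋ, ẏ, ż)`. -/
noncomputable def lagrangian (p : Heis) (v : ℝ × ℝ × ℝ) : ℝ :=
  (1 / 2) * (v.1 ^ 2 + v.2.1 ^ 2 + (v.2.2 - p.x * v.2.1) ^ 2) + v.2.2 - p.x * v.2.1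

/-- The velocity of a curve, in coordinates. -/
noncomputable def velocity (γ : ℝ → Heis) (t : ℝ) : ℝ × ℝ × ℝ :=
  (deriv (fun s => (γ s).x) t, deriv (fun s => (γ s).y) t, deriv (fun s => (γ s).z) t)

/-- The Lagrangian is invariant under left translations, so it descends to all quotients
`Δ \ G`. -/
theorem lagrangian_left_invariant (a : Heis) (γ : ℝ → Heis) (t : ℝ)
    (hy : DifferentiableAt ℝ (fun s => (γ s).y) t)
    (hz : DifferentiableAt ℝ (fun s => (γ s).z) t) :
    lagrangian (a * γ t) (velocity (fun s => a * γ s) t) = lagrangian (γ t) (velocity γ t) := by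
  have h : deriv (fun s => a.z + (γ s).z + a.x * (γ s).y) t =
      deriv (fun s => (γ s).z) t + a.x * deriv (fun s => (γ s).y) t :=
    ((hz.hasDerivAt.const_add a.z).add (hy.hasDerivAt.const_mul a.x)).deriv
  simp only [lagrangian, velocity, Heis.mul_x, Heis.mul_y, Heis.mul_z, deriv_const_add, h]
  ring

/-- `γ` restricted to `[0, T]` is an absolutely continuous curve in `G = ℝ³`. -/
def IsACCurve (T : ℝ) (γ : ℝ → Heis) : Prop :=
  AbsolutelyContinuousOnInterval (fun t => (γ t).x) 0 T ∧
  AbsolutelyContinuousOnInterval (fun t => (γ t).y) 0 T ∧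
  AbsolutelyContinuousOnInterval (fun t => (γ t).z) 0 T

/-- The extended-real integral `∫ f⁺ - ∫ f⁻` over `[0, T]`. The integrands used here are bounded
below, so `∫ f⁻` is finite, and the value is `⊤` where `f` is not integrable. -/
noncomputable def extIntegral (T : ℝ) (f : ℝ → ℝ) : EReal :=
  ((∫⁻ t in Icc 0 T, ENNReal.ofReal (f t) : ℝ≥0∞) : EReal) -
    ((∫⁻ t in Icc 0 T, ENNReal.ofReal (-f t) : ℝ≥0∞) : EReal)

/-- The action `A_{L+k}(γ)` of a curve `γ : [0, T] → G`. -/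
noncomputable def action (k T : ℝ) (γ : ℝ → Heis) : EReal :=
  extIntegral T (fun t => lagrangian (γ t) (velocity γ t) + k)

/-- The critical value `inf {k : A_{L+k}(γ) ≥ 0 for every absolutely continuous loop γ}` of the
cover `Δ \ G`. A loop in `Δ \ G` is given by a lift to `G`, that is, an absolutely continuous curve
in `G` whose end points have the same projection. -/
noncomputable def criticalValue (Δ : Subgroup Heis) : ℝ :=
  sInf {k : ℝ | ∀ (T : ℝ) (γ : ℝ → Heis), 0 < T → IsACCurve T γ →
    proj Δ (γ 0) = proj Δ (γ T) → 0 ≤ action k T γ}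

/-- `c_u`: the critical value of the universal cover `G = ℝ³` of `M`. -/
noncomputable def cu : ℝ := criticalValue ⊥

/-- `c_a`: the critical value of the abelian cover `[Γ, Γ] \ G` of `M`, whose group of deck
transformations is `Γ / [Γ, Γ] = H₁(M; ℤ)`. -/
noncomputable def ca : ℝ := criticalValue ⁅lattice, lattice⁆

/-- The finite time potential `h^T(p, q)` on the universal cover: the infimum of the action `A_L`
over the absolutely continuous curves `γ : [0, T] → G` from `p` to `q`. -/
noncomputable def potential (T : ℝ) (p q : Heis) : EReal :=
  sInf {a : EReal | ∃ γ : ℝ → Heis, IsACCurve T γ ∧ γ 0 = p ∧ γ T = q ∧ a = action 0 T γ}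

/-- The Peierls barrier `h(p, q) = liminf_{T → +∞} (h^T(p, q) + c_u T)` on the universal cover. -/
noncomputable def peierlsBarrier (p q : Heis) : EReal :=
  liminf (fun T : ℝ => potential T p q + ((cu * T : ℝ) : EReal)) atTop

/-- The projected Aubry set of the universal cover. -/
def projectedAubrySet : Set Heis := {p | peierlsBarrier p p = 0}

end HeisenbergExample

/-! Put `w = ż - xẏ`. Then `L + 1/2 = ½(ẋ² + ẏ² + (1 + w)²)`, so the action of `L + k` is
nonnegative on all curves once `k ≥ 1/2`. Zero cost forces steady descent along the centre with `w =
-1`. A loop in `G` has `∫ w = -∫ x dy`, so it can keep `w = -1` only if its planar projection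
encloses area `T`. By the isoperimetric inequality this costs at least `2π`, whatever `T` is, and a
circle of area `T` attains it. Allowing other `w` saves at most `2π²/T`, whence `h(p,p) = 2π`. These
same loops, closed already in `G`, have negative action for `k < 1/2` and large `T`, so every cover
has critical value `1/2`. The carrying lemmas are `isoperimetric`, `le_action_of_loop` and
`exists_spiral`. -/

namespace HeisenbergExample

/-! ### Wirtinger and isoperimetric inequalities. -/

open Real in
/-- A Wirtinger-type inequality, obtained by completing a square with the solution
`g = l * tan (l * (t - m))` of the Riccati equation `g' = l ^ 2 + g ^ 2`. -/
theorem sq_mul_integral_sq_le_of_cos_pos {f : ℝ → ℝ} {a b l m : ℝ} (hab : a ≤ b)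
    (hf : AbsolutelyContinuousOnInterval f a b)
    (hf2 : IntervalIntegrable (fun t => deriv f t ^ 2) volume a b)
    (hcos : ∀ t ∈ Icc a b, 0 < cos (l * (t - m))) :
    l ^ 2 * ∫ t in a..b, f t ^ 2 ≤ (∫ t in a..b, deriv f t ^ 2) +
      (f b ^ 2 * (l * tan (l * (b - m))) - f a ^ 2 * (l * tan (l * (a - m)))) := by
  set g : ℝ → ℝ := fun t => l * tan (l * (t - m)) with hg
  have hu : uIcc a b = Icc a b := uIcc_of_le hab
  have hgd : ∀ t ∈ Icc a b, HasDerivAt g (l ^ 2 + g t ^ 2) t := by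
    intro t ht
    have hc := (hcos t ht).ne'
    have h1 : HasDerivAt (fun t => l * (t - m)) l t := by
      simpa using ((hasDerivAt_id t).sub_const m).const_mul l
    refine (((hasDerivAt_tan hc).comp t h1).const_mul l).congr_deriv ?_
    rw [hg]
    simp only [tan_eq_sin_div_cos]
    field_simp
    linear_combination (-l ^ 2) * sin_sq_add_cos_sq (l * (t - m))
  have hgac : AbsolutelyContinuousOnInterval g a b := by
    refine ContDiffOn.absolutelyContinuousOnInterval fun t ht => ?_
    refine ContDiffAt.contDiffWithinAt ?_
    have hc := (hcos t (hu ▸ ht)).ne'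
    have h1 : ContDiffAt ℝ 1 (fun t => l * (t - m)) t := by fun_prop
    exact contDiffAt_const.mul (ContDiffAt.comp (g := tan) t (contDiffAt_tan.2 hc) h1)
  have hh := (hf.fun_mul hf).fun_mul hgac
  have hI := hh.integral_deriv_eq_sub
  have hfi : IntervalIntegrable (fun t => l ^ 2 * f t ^ 2) volume a b :=
    ((hf.continuousOn.pow 2).intervalIntegrable).const_mul _
  -- By the Riccati equation the integrand is `(f' + g f)²` almost everywhere.
  have key : 0 ≤ ∫ t in a..b,
      (deriv f t ^ 2 - l ^ 2 * f t ^ 2 + deriv (fun t => f t * f t * g t) t) := by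
    refine intervalIntegral.integral_nonneg_of_ae_restrict hab ?_
    rw [EventuallyLE, ae_restrict_iff' measurableSet_Icc]
    filter_upwards [hf.ae_differentiableAt] with t ht hmem
    have hd := (ht (hu ▸ hmem)).hasDerivAt
    have := ((hd.mul hd).mul (hgd t hmem)).deriv
    simp only [Pi.mul_def] at this
    rw [this]
    simp only [Pi.zero_apply]
    nlinarith [sq_nonneg (deriv f t + g t * f t)]
  rw [intervalIntegral.integral_add (hf2.sub hfi) hh.intervalIntegrable_deriv,
    intervalIntegral.integral_sub hf2 hfi, intervalIntegral.integral_const_mul, hI] at key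
  have e1 : f b ^ 2 * g b = f b * f b * g b := by ring
  have e2 : f a ^ 2 * g a = f a * f a * g a := by ring
  linarith

open Real in
/-- Wirtinger's inequality for closed curves, with all constants below the optimal one. -/
theorem exists_const_sq_mul_integral_sq_le {f : ℝ → ℝ} {T : ℝ} (hT : 0 < T)
    (hf : AbsolutelyContinuousOnInterval f 0 T) (hper : f 0 = f T)
    (hf2 : IntervalIntegrable (fun t => deriv f t ^ 2) volume 0 T) :
    ∃ c : ℝ, ∀ l : ℝ, 0 < l → l < 2 * π / T →
      l ^ 2 * ∫ t in (0 : ℝ)..T, (f t - c) ^ 2 ≤ ∫ t in (0 : ℝ)..T, deriv f t ^ 2 := by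
  have hu : uIcc 0 T = Icc 0 T := uIcc_of_le hT.le
  -- The difference `f (t + T/2) - f t` takes opposite values at `0` and `T/2`. With `c = f s`, the
  -- function `f - c` vanishes at two points half a period apart.
  obtain ⟨s, hs, hfs⟩ : ∃ s ∈ Icc 0 (T / 2), f (s + T / 2) = f s := by
    have hcont : ContinuousOn (fun t => f (t + T / 2) - f t) (uIcc 0 (T / 2)) := by
      rw [uIcc_of_le (by linarith)]
      have hc := hu ▸ hf.continuousOn
      refine (hc.comp (by fun_prop) fun t ht => ?_).sub (hc.mono ?_)
      · simp only [mem_Icc] at ht ⊢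
        constructor <;> linarith
      · exact Icc_subset_Icc_right (by linarith)
    have h0 : (0 : ℝ) ∈ uIcc (f (0 + T / 2) - f 0) (f (T / 2 + T / 2) - f (T / 2)) := by
      rw [zero_add, add_halves, ← hper, mem_uIcc]
      rcases le_total (f (T / 2)) (f 0) with h | h
      · left; constructor <;> linarith
      · right; constructor <;> linarith
    obtain ⟨s, hs, h⟩ := intermediate_value_uIcc hcont h0
    rw [uIcc_of_le (by linarith)] at hs
    exact ⟨s, hs, sub_eq_zero.1 h⟩
  refine ⟨f s, fun l hl0 hl => ?_⟩
  obtain ⟨hs0, hs1⟩ := hs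
  have hlT : l * T < 2 * π := by rwa [lt_div_iff₀ hT] at hl
  have hpiece : ∀ a b m : ℝ, 0 ≤ a → a ≤ b → b ≤ T → m - T / 4 ≤ a → b ≤ m + T / 4 → _ :=
    fun a b m ha hab hb hma hmb =>
      sq_mul_integral_sq_le_of_cos_pos (f := fun t => f t - f s) (a := a) (b := b) (l := l)
        (m := m) hab
        ((hf.fun_sub (contDiff_const (c := f s)).contDiffOn.absolutelyContinuousOnInterval).mono
          (by rw [hu, uIcc_of_le hab]; exact Icc_subset_Icc ha hb))
        (by
          simp only [deriv_sub_const]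
          exact hf2.mono_set (by rw [hu, uIcc_of_le hab]; exact Icc_subset_Icc ha hb))
        (fun t ht => by
          have h1 : l * (t - m) ≤ l * (T / 4) := by
            gcongr; linarith [ht.2]
          have h2 : l * (-(T / 4)) ≤ l * (t - m) := by
            gcongr; linarith [ht.1]
          exact cos_pos_of_mem_Ioo ⟨by linarith, by linarith⟩)
  -- The outer pieces form one half-period across the endpoint. Their centres differ by `T`, so the
  -- boundary terms at `0` and `T` cancel.
  have p1 := hpiece 0 s (s - T / 4) le_rfl hs0 (by linarith) (by linarith) (by linarith)
  have p2 := hpiece s (s + T / 2) (s + T / 4) hs0 (by linarith) (by linarith) (by linarith)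
    (by linarith)
  have p3 := hpiece (s + T / 2) T (s + 3 * T / 4) (by linarith) (by linarith) le_rfl
    (by linarith) (by linarith)
  simp only [deriv_sub_const, hfs, sub_self] at p1 p2 p3
  have hsub : ∀ a b : ℝ, 0 ≤ a → a ≤ b → b ≤ T → uIcc a b ⊆ uIcc 0 T := fun a b ha hab hb => by
    rw [hu, uIcc_of_le hab]; exact Icc_subset_Icc ha hb
  have hi : IntervalIntegrable (fun t => (f t - f s) ^ 2) volume 0 T :=
    ((hf.continuousOn.sub continuousOn_const).pow 2).intervalIntegrable
  have split : ∀ F : ℝ → ℝ, IntervalIntegrable F volume 0 T →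
      ∫ t in (0 : ℝ)..T, F t = (∫ t in (0 : ℝ)..s, F t) + (∫ t in s..(s + T / 2), F t) +
        ∫ t in (s + T / 2)..T, F t := by
    intro F hF
    have i1 := hF.mono_set (hsub 0 s le_rfl hs0 (by linarith))
    have i2 := hF.mono_set (hsub s (s + T / 2) hs0 (by linarith) (by linarith))
    have i3 := hF.mono_set (hsub (s + T / 2) T (by linarith) (by linarith) le_rfl)
    rw [intervalIntegral.integral_add_adjacent_intervals i1 i2,
      intervalIntegral.integral_add_adjacent_intervals (i1.trans i2) i3]
  rw [split _ hi, split _ hf2]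
  have e : l * (T - (s + 3 * T / 4)) = l * (0 - (s - T / 4)) := by ring
  rw [e, ← hper] at p3
  linarith

open Real in
/-- The isoperimetric inequality in the plane, for the energy of absolutely continuous closed
curves. -/
theorem isoperimetric {x y : ℝ → ℝ} {T : ℝ} (hT : 0 < T)
    (hx : AbsolutelyContinuousOnInterval x 0 T) (hy : AbsolutelyContinuousOnInterval y 0 T)
    (hxT : x 0 = x T) (hyT : y 0 = y T)
    (hx2 : IntervalIntegrable (fun t => deriv x t ^ 2) volume 0 T)
    (hy2 : IntervalIntegrable (fun t => deriv y t ^ 2) volume 0 T) :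
    4 * π / T * ∫ t in (0 : ℝ)..T, x t * deriv y t ≤
      (∫ t in (0 : ℝ)..T, deriv x t ^ 2) + ∫ t in (0 : ℝ)..T, deriv y t ^ 2 := by
  obtain ⟨c, hc⟩ := exists_const_sq_mul_integral_sq_le hT hx hxT hx2
  have hyi := hy.intervalIntegrable_deriv
  have hxy : IntervalIntegrable (fun t => x t * deriv y t) volume 0 T :=
    hyi.continuousOn_mul hx.continuousOn
  have hi : IntervalIntegrable (fun t => (x t - c) ^ 2) volume 0 T :=
    ((hx.continuousOn.sub continuousOn_const).pow 2).intervalIntegrable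
  have hshift : ∫ t in (0 : ℝ)..T, (x t - c) * deriv y t = ∫ t in (0 : ℝ)..T, x t * deriv y t := by
    simp only [sub_mul]
    rw [intervalIntegral.integral_sub hxy (hyi.const_mul c), intervalIntegral.integral_const_mul,
      hy.integral_deriv_eq_sub, hyT]
    simp
  have hxcy : IntervalIntegrable (fun t => (x t - c) * deriv y t) volume 0 T :=
    hyi.continuousOn_mul (hx.continuousOn.sub continuousOn_const)
  have hpos : 0 < 2 * π / T := by positivity
  have hl : ∀ l ∈ Ioo 0 (2 * π / T), 2 * l * ∫ t in (0 : ℝ)..T, x t * deriv y t ≤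
      (∫ t in (0 : ℝ)..T, deriv x t ^ 2) + ∫ t in (0 : ℝ)..T, deriv y t ^ 2 := by
    intro l hl
    have h1 := hc l hl.1 hl.2
    have h2 : ∫ t in (0 : ℝ)..T, 2 * l * ((x t - c) * deriv y t) ≤
        ∫ t in (0 : ℝ)..T, (l ^ 2 * (x t - c) ^ 2 + deriv y t ^ 2) := by
      refine intervalIntegral.integral_mono_on hT.le (hxcy.const_mul _)
        ((hi.const_mul _).add hy2) fun t _ => ?_
      nlinarith [sq_nonneg (l * (x t - c) - deriv y t)]
    rw [intervalIntegral.integral_add (hi.const_mul _) hy2, intervalIntegral.integral_const_mul,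
      intervalIntegral.integral_const_mul, hshift] at h2
    linarith
  -- At `l = 2π/T` itself the tangent blows up at the ends of the half-periods, so the sharp
  -- constant comes from a limit.
  have hlim : Tendsto (fun l : ℝ => 2 * l * ∫ t in (0 : ℝ)..T, x t * deriv y t)
      (nhdsWithin (2 * π / T) (Iio (2 * π / T)))
      (nhds (2 * (2 * π / T) * ∫ t in (0 : ℝ)..T, x t * deriv y t)) :=
    (Continuous.tendsto (by fun_prop) _).mono_left nhdsWithin_le_nhds
  have := le_of_tendsto hlim (eventually_of_mem (Ioo_mem_nhdsLT hpos) hl)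
  calc _ = 2 * (2 * π / T) * ∫ t in (0 : ℝ)..T, x t * deriv y t := by ring
    _ ≤ _ := this

/-! ### Lower bounds for the action. -/

theorem lagrangian_add_half (p : Heis) (v : ℝ × ℝ × ℝ) :
    lagrangian p v + 1 / 2 =
      1 / 2 * (v.1 ^ 2 + v.2.1 ^ 2 + (1 + (v.2.2 - p.x * v.2.1)) ^ 2) := by
  simp only [lagrangian]
  ring

theorem neg_half_le_lagrangian (p : Heis) (v : ℝ × ℝ × ℝ) : -(1 / 2) ≤ lagrangian p v := by
  have := lagrangian_add_half p v
  have : 0 ≤ lagrangian p v + 1 / 2 := by rw [this]; positivity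
  linarith

theorem extIntegral_nonneg {T : ℝ} {f : ℝ → ℝ} (hf : ∀ t, 0 ≤ f t) : 0 ≤ extIntegral T f := by
  have : ∀ t, ENNReal.ofReal (-f t) = 0 := fun t => ENNReal.ofReal_of_nonpos (by linarith [hf t])
  simp only [extIntegral, this, lintegral_zero, EReal.coe_ennreal_zero, sub_zero]
  exact EReal.coe_ennreal_nonneg _

theorem extIntegral_eq_integral {T : ℝ} {f : ℝ → ℝ} (hf : IntegrableOn f (Icc 0 T)) :
    extIntegral T f = ((∫ t in Icc 0 T, f t : ℝ) : EReal) := by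
  rw [extIntegral, integral_eq_lintegral_pos_part_sub_lintegral_neg_part hf, EReal.coe_sub]
  congr 1
  · exact (EReal.coe_ennreal_toReal hf.lintegral_lt_top.ne).symm
  · exact (EReal.coe_ennreal_toReal hf.neg.lintegral_lt_top.ne).symm

theorem extIntegral_eq_top {T C : ℝ} {f : ℝ → ℝ}
    (hm : AEStronglyMeasurable f (volume.restrict (Icc 0 T))) (hC : ∀ t, -C ≤ f t)
    (hf : ¬ IntegrableOn f (Icc 0 T)) : extIntegral T f = ⊤ := by
  have hneg : ∫⁻ t in Icc 0 T, ENNReal.ofReal (-f t) < ⊤ := by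
    calc _ ≤ ∫⁻ t in Icc 0 T, ENNReal.ofReal C :=
          lintegral_mono fun t => ENNReal.ofReal_le_ofReal (by linarith [hC t])
      _ < ⊤ := by simp [ENNReal.mul_lt_top]
  have hpos : ∫⁻ t in Icc 0 T, ENNReal.ofReal (f t) = ⊤ := by
    by_contra h
    refine hf ⟨hm, ?_⟩
    rw [hasFiniteIntegral_iff_norm]
    calc _ ≤ ∫⁻ t in Icc 0 T, (ENNReal.ofReal (f t) + ENNReal.ofReal (-f t)) := by
          refine lintegral_mono fun t => ?_
          rcases le_total 0 (f t) with h | h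
          · simp [abs_of_nonneg h]
          · simp [abs_of_nonpos h]
      _ = _ := lintegral_add_left' hm.aemeasurable.ennreal_ofReal _
      _ < ⊤ := ENNReal.add_lt_top.2 ⟨lt_top_iff_ne_top.2 h, hneg⟩
  rw [extIntegral, hpos, EReal.coe_ennreal_top]
  lift (∫⁻ t in Icc 0 T, ENNReal.ofReal (-f t)) to NNReal using hneg.ne with r
  exact EReal.top_sub_coe (r : ℝ)

/-- The lower bound for the action of loops of period `T` in the Heisenberg group. -/
theorem le_action_of_loop {T : ℝ} (hT : 0 < T) {γ : ℝ → Heis} (hγ : IsACCurve T γ)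
    (hloop : γ 0 = γ T) :
    ((2 * Real.pi - 2 * Real.pi ^ 2 / T - T / 2 : ℝ) : EReal) ≤ action 0 T γ := by
  obtain ⟨hx, hy, hz⟩ := hγ
  have hu : uIcc 0 T = Icc 0 T := uIcc_of_le hT.le
  have hxc : ContinuousOn (fun t => (γ t).x) (Icc 0 T) := hu ▸ hx.continuousOn
  have hxm := hxc.aestronglyMeasurable measurableSet_Icc (μ := volume)
  have mx := (measurable_deriv (fun t => (γ t).x)).aestronglyMeasurable
    (μ := volume.restrict (Icc 0 T))
  have my := (measurable_deriv (fun t => (γ t).y)).aestronglyMeasurable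
    (μ := volume.restrict (Icc 0 T))
  have mz := (measurable_deriv (fun t => (γ t).z)).aestronglyMeasurable
    (μ := volume.restrict (Icc 0 T))
  have hm : AEStronglyMeasurable (fun t => lagrangian (γ t) (velocity γ t) + 0)
      (volume.restrict (Icc 0 T)) := by
    simp only [lagrangian, velocity]
    exact (((((mx.pow 2).add (my.pow 2)).add ((mz.sub (hxm.mul my)).pow 2)).const_mul _).add
      mz |>.sub (hxm.mul my)).add_const 0
  by_cases hf : IntegrableOn (fun t => lagrangian (γ t) (velocity γ t) + 0) (Icc 0 T)
  swap
  · rw [action, extIntegral_eq_top (C := 1 / 2) hm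
      (fun t => by linarith [neg_half_le_lagrangian (γ t) (velocity γ t)]) hf]
    exact le_top
  rw [action, extIntegral_eq_integral hf, EReal.coe_le_coe_iff, integral_Icc_eq_integral_Ioc,
    ← intervalIntegral.integral_of_le hT.le]
  -- `2L + 1` is a sum of three squares, so it dominates `ẋ²` and `ẏ²`.
  have hdom : IntegrableOn (fun t => 2 * (lagrangian (γ t) (velocity γ t) + 0) + 1) (Icc 0 T) :=
    (hf.const_mul 2).add (integrable_const 1)
  have hfi : IntervalIntegrable (fun t => lagrangian (γ t) (velocity γ t) + 0) volume 0 T :=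
    (intervalIntegrable_iff_integrableOn_Icc_of_le hT.le).2 hf
  have hx2 : IntervalIntegrable (fun t => deriv (fun s => (γ s).x) t ^ 2) volume 0 T := by
    rw [intervalIntegrable_iff_integrableOn_Icc_of_le hT.le]
    refine Integrable.mono' hdom (mx.pow 2) (Eventually.of_forall fun t => ?_)
    have := lagrangian_add_half (γ t) (velocity γ t)
    rw [Real.norm_of_nonneg (sq_nonneg _)]
    simp only [velocity] at this ⊢
    nlinarith [sq_nonneg (deriv (fun s => (γ s).y) t),
      sq_nonneg (1 + (deriv (fun s => (γ s).z) t - (γ t).x * deriv (fun s => (γ s).y) t))]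
  have hy2 : IntervalIntegrable (fun t => deriv (fun s => (γ s).y) t ^ 2) volume 0 T := by
    rw [intervalIntegrable_iff_integrableOn_Icc_of_le hT.le]
    refine Integrable.mono' hdom (my.pow 2) (Eventually.of_forall fun t => ?_)
    have := lagrangian_add_half (γ t) (velocity γ t)
    rw [Real.norm_of_nonneg (sq_nonneg _)]
    simp only [velocity] at this ⊢
    nlinarith [sq_nonneg (deriv (fun s => (γ s).x) t),
      sq_nonneg (1 + (deriv (fun s => (γ s).z) t - (γ t).x * deriv (fun s => (γ s).y) t))]
  have iso := isoperimetric hT hx hy (by rw [hloop]) (by rw [hloop]) hx2 hy2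
  have hxy : IntervalIntegrable (fun t => (γ t).x * deriv (fun s => (γ s).y) t) volume 0 T :=
    hy.intervalIntegrable_deriv.continuousOn_mul hx.continuousOn
  have hzi := hz.intervalIntegrable_deriv
  have hz0 : ∫ t in (0 : ℝ)..T, deriv (fun s => (γ s).z) t = 0 := by
    rw [hz.integral_deriv_eq_sub, hloop, sub_self]
  -- The tangent line bound `½(1 + w)² ≥ c(1 + w) - c²/2` is used with the slope `c` for which `c ∫
  -- w = -c ∫ x dy` is absorbed by the isoperimetric inequality.
  set c : ℝ := 2 * Real.pi / T with hc
  have i1 := (hx2.add hy2).const_mul (1 / 2)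
  have i2 := (hzi.sub hxy).const_mul c
  have i3 : IntervalIntegrable (fun _ : ℝ => c - c ^ 2 / 2 - 1 / 2) volume 0 T :=
    intervalIntegrable_const
  have hmono := intervalIntegral.integral_mono_on hT.le ((i1.add i2).add i3) hfi fun t _ => by
    have := lagrangian_add_half (γ t) (velocity γ t)
    simp only [velocity] at this ⊢
    nlinarith [sq_nonneg
      (1 + (deriv (fun s => (γ s).z) t - (γ t).x * deriv (fun s => (γ s).y) t) - c)]
  have e : 2 * Real.pi - 2 * Real.pi ^ 2 / T - T / 2 = (c - c ^ 2 / 2 - 1 / 2) * T := by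
    rw [hc]
    field_simp
  refine le_trans ?_ hmono
  rw [intervalIntegral.integral_add (i1.add i2) i3, intervalIntegral.integral_add i1 i2,
      intervalIntegral.integral_const_mul, intervalIntegral.integral_const_mul,
      intervalIntegral.integral_add hx2 hy2, intervalIntegral.integral_sub hzi hxy, hz0,
      intervalIntegral.integral_const, e]
  have : 4 * Real.pi / T = 2 * c := by rw [hc]; ring
  rw [this] at iso
  simp only [sub_zero, smul_eq_mul]
  linarith

/-! ### Explicit curves and upper bounds for the action. -/

open Real in
/-- A curve from `p` to `q` whose projection to the plane winds once around a disc of area `T`,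
up to a drift. -/
theorem exists_spiral {T : ℝ} (hT : 0 < T) (p q : Heis) :
    ∃ γ : ℝ → Heis, IsACCurve T γ ∧ γ 0 = p ∧ γ T = q ∧
      ∀ t, lagrangian (γ t) (velocity γ t) + 1 / 2 =
        1 / 2 * (((q.x - p.x) / T - √(T / π) * (2 * π / T) * sin (2 * π / T * t)) ^ 2 +
          ((q.y - p.y) / T + √(T / π) * (2 * π / T) * cos (2 * π / T * t)) ^ 2 +
          ((q.z - p.z - p.x * (q.y - p.y) - (q.x - p.x) * (q.y - p.y) / 2 +
            √(T / π) * (q.y - p.y)) / T) ^ 2) := by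
  set R := √(T / π) with hR
  set ω := 2 * π / T with hω
  set α := (q.x - p.x) / T with hα
  set β := (q.y - p.y) / T with hβ
  set K := q.z - p.z - p.x * (q.y - p.y) - (q.x - p.x) * (q.y - p.y) / 2 + R * (q.y - p.y) with hK
  have hR2 : R ^ 2 = T / π := sq_sqrt (by positivity)
  have hω0 : ω ≠ 0 := by positivity
  have hωT : ω * T = 2 * π := by rw [hω]; field_simp
  have hαT : α * T = q.x - p.x := by rw [hα]; field_simp
  have hβT : β * T = q.y - p.y := by rw [hβ]; field_simp
  have hRπ : R ^ 2 * π = T := by rw [hR2]; field_simp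
  clear_value R ω α β K
  let x : ℝ → ℝ := fun t => p.x + α * t + R * (cos (ω * t) - 1)
  let y : ℝ → ℝ := fun t => p.y + β * t + R * sin (ω * t)
  -- An antiderivative of `xẏ + (K/T - 1)`, so that `1 + w = K/T` is constant. Since `πR² = T`, the
  -- disc contributes `T` to `∫ x dy`, and `K` is the remaining height to be made up.
  let z : ℝ → ℝ := fun t => p.z + ((p.x - R) * (β * t + R * sin (ω * t)) + α * β * t ^ 2 / 2 +
    α * R * (t * sin (ω * t) + (cos (ω * t) - 1) / ω) + R * β * (sin (ω * t) / ω) +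
    R ^ 2 * (ω * t + sin (ω * t) * cos (ω * t)) / 2) + (K / T - 1) * t
  have hs : ∀ t, HasDerivAt (fun t => sin (ω * t)) (cos (ω * t) * ω) t := fun t =>
    (hasDerivAt_sin (ω * t)).comp t (by simpa using (hasDerivAt_id t).const_mul ω)
  have hc : ∀ t, HasDerivAt (fun t => cos (ω * t)) (-sin (ω * t) * ω) t := fun t =>
    (hasDerivAt_cos (ω * t)).comp t (by simpa using (hasDerivAt_id t).const_mul ω)
  have hl : ∀ a t : ℝ, HasDerivAt (fun t => a * t) a t := fun a t => by
    simpa using (hasDerivAt_id t).const_mul a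
  have hx : ∀ t, HasDerivAt x (α - R * ω * sin (ω * t)) t := fun t =>
    (((hl α t).const_add p.x).add (((hc t).sub_const 1).const_mul R)).congr_deriv (by ring)
  have hy : ∀ t, HasDerivAt y (β + R * ω * cos (ω * t)) t := fun t =>
    (((hl β t).const_add p.y).add ((hs t).const_mul R)).congr_deriv (by ring)
  have hz : ∀ t, HasDerivAt z (x t * (β + R * ω * cos (ω * t)) + (K / T - 1)) t := fun t => by
    have h1 := ((hl β t).add ((hs t).const_mul R)).const_mul (p.x - R)
    have h2 := ((hasDerivAt_pow 2 t).const_mul (α * β)).div_const 2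
    have h3 := (((hasDerivAt_id t).mul (hs t)).add
      (((hc t).sub_const 1).div_const ω)).const_mul (α * R)
    have h4 := ((hs t).div_const ω).const_mul (R * β)
    have h5 := (((hl ω t).add ((hs t).mul (hc t))).const_mul (R ^ 2)).div_const 2
    refine (((((((h1.add h2).add h3).add h4).add h5)).const_add p.z).add
      (hl (K / T - 1) t)).congr_deriv ?_
    simp only [x, id]
    field_simp
    linear_combination (-(R ^ 2 * ω * T)) * sin_sq_add_cos_sq (ω * t)
  refine ⟨fun t => ⟨x t, y t, z t⟩, ⟨?_, ?_, ?_⟩, ?_, ?_, fun t => ?_⟩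
  · exact ContDiffOn.absolutelyContinuousOnInterval (ContDiff.contDiffOn (by fun_prop))
  · exact ContDiffOn.absolutelyContinuousOnInterval (ContDiff.contDiffOn (by fun_prop))
  · exact ContDiffOn.absolutelyContinuousOnInterval (ContDiff.contDiffOn (by fun_prop))
  · ext <;> simp [x, y, z]
  · ext
    · simp only [x, hωT, cos_two_pi, hαT]; ring
    · simp only [y, hωT, sin_two_pi, hβT]; ring
    · have e : (K / T - 1) * T = K - T := by field_simp
      have e2 : α * β * T ^ 2 = (q.x - p.x) * (q.y - p.y) := by rw [← hαT, ← hβT]; ring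
      simp only [z, hωT, cos_two_pi, sin_two_pi, e, e2, hβT]
      linear_combination hRπ + hK
  · rw [lagrangian_add_half]
    simp only [velocity, (hx t).deriv, (hy t).deriv, (hz t).deriv]
    ring

theorem action_le_of_bound {T k C : ℝ} (hT : 0 < T) {γ : ℝ → Heis}
    (hc : Continuous fun t => lagrangian (γ t) (velocity γ t))
    (hC : ∀ t, lagrangian (γ t) (velocity γ t) + 1 / 2 ≤ C / T) :
    action k T γ ≤ ((C + (k - 1 / 2) * T : ℝ) : EReal) := by
  have hi : IntegrableOn (fun t => lagrangian (γ t) (velocity γ t) + k) (Icc 0 T) :=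
    (hc.add continuous_const).integrableOn_Icc
  rw [action, extIntegral_eq_integral hi, EReal.coe_le_coe_iff]
  calc _ ≤ ∫ t in Icc 0 T, (C / T + (k - 1 / 2)) :=
        integral_mono hi (integrable_const _) fun t => by linarith [hC t]
    _ = C + (k - 1 / 2) * T := by
        simp [hT.le]
        field_simp

open Real in
theorem exists_loop_action_le {T : ℝ} (hT : 0 < T) (p : Heis) :
    ∃ γ : ℝ → Heis, IsACCurve T γ ∧ γ 0 = p ∧ γ T = p ∧
      ∀ k, action k T γ ≤ ((2 * π + (k - 1 / 2) * T : ℝ) : EReal) := by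
  obtain ⟨γ, hγ, h0, h1, h⟩ := exists_spiral hT p p
  have hL : ∀ t, lagrangian (γ t) (velocity γ t) + 1 / 2 = 2 * π / T := fun t => by
    rw [h t]
    have hR2 : √(T / π) ^ 2 = T / π := sq_sqrt (by positivity)
    calc _ = 1 / 2 * (√(T / π) ^ 2 * (2 * π / T) ^ 2 *
          (sin (2 * π / T * t) ^ 2 + cos (2 * π / T * t) ^ 2)) := by ring
      _ = _ := by
        rw [sin_sq_add_cos_sq, hR2]
        field_simp
  refine ⟨γ, hγ, h0, h1, fun k => action_le_of_bound hT ?_ fun t => (hL t).le⟩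
  have : (fun t => lagrangian (γ t) (velocity γ t)) = fun _ => 2 * π / T - 1 / 2 :=
    funext fun t => by linarith [hL t]
  rw [this]
  exact continuous_const

open Real in
-- The radius grows like `√T`, so the rotation speed and the correction `R b / T` are of order
-- `1/√T`. Their squares, and those of the drift terms, are `O(1/T)`, and the cost over `[0, T]`
-- stays bounded.
theorem exists_forall_curve_action_le (p q : Heis) :
    ∃ C : ℝ, ∀ T, 1 ≤ T → ∃ γ : ℝ → Heis, IsACCurve T γ ∧ γ 0 = p ∧ γ T = q ∧
      ∀ k, action k T γ ≤ ((C + (k - 1 / 2) * T : ℝ) : EReal) := by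
  set a := q.x - p.x with ha
  set b := q.y - p.y with hb
  set K := q.z - p.z - p.x * b - a * b / 2 with hK
  refine ⟨a ^ 2 + b ^ 2 + 4 * π + K ^ 2 + b ^ 2 / π, fun T h1 => ?_⟩
  have hT : 0 < T := by linarith
  obtain ⟨γ, hγ, h0, hT', h⟩ := exists_spiral hT p q
  simp only [← ha, ← hb, ← hK] at h
  refine ⟨γ, hγ, h0, hT', fun k => action_le_of_bound hT ?_ fun t => ?_⟩
  · have : (fun t => lagrangian (γ t) (velocity γ t)) = fun t => _ :=
      funext fun t => eq_sub_of_add_eq (h t)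
    rw [this]
    fun_prop
  · rw [h t]
    have hR2 : √(T / π) ^ 2 = T / π := sq_sqrt (by positivity)
    set R := √(T / π)
    set s := sin (2 * π / T * t)
    set c := cos (2 * π / T * t)
    have hsc : s ^ 2 + c ^ 2 = 1 := sin_sq_add_cos_sq _
    have hT2 : ∀ d : ℝ, (d / T) ^ 2 ≤ d ^ 2 / T := fun d => by
      rw [div_pow]
      gcongr
      nlinarith
    have hw : (R * b / T) ^ 2 = b ^ 2 / π / T := by
      rw [div_pow, mul_pow, hR2]
      field_simp
    have hv : (R * (2 * π / T)) ^ 2 = 4 * π / T := by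
      rw [mul_pow, hR2]
      field_simp
      norm_num
    calc _ ≤ (a / T) ^ 2 + (b / T) ^ 2 + (R * (2 * π / T)) ^ 2 * (s ^ 2 + c ^ 2) +
          (K / T) ^ 2 + (R * b / T) ^ 2 := by
          rw [add_div]
          nlinarith [sq_nonneg (a / T + R * (2 * π / T) * s),
            sq_nonneg (b / T - R * (2 * π / T) * c), sq_nonneg (K / T - R * b / T)]
      _ ≤ a ^ 2 / T + b ^ 2 / T + 4 * π / T * 1 + K ^ 2 / T + b ^ 2 / π / T := by
          rw [hsc, hv, hw]
          gcongr <;> exact hT2 _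
      _ = _ := by ring

/-! ### Critical values and the Peierls barrier. -/

theorem action_nonneg {k T : ℝ} (hk : 1 / 2 ≤ k) (γ : ℝ → Heis) : 0 ≤ action k T γ :=
  extIntegral_nonneg fun t => by linarith [neg_half_le_lagrangian (γ t) (velocity γ t)]

theorem criticalValue_eq_half (Δ : Subgroup Heis) : criticalValue Δ = 1 / 2 := by
  refine Eq.trans (congrArg sInf ?_) (csInf_Ici (a := (1 / 2 : ℝ)))
  ext k
  refine Iff.trans ?_ mem_Ici.symm
  refine ⟨fun h => ?_, fun hk T γ _ _ _ => action_nonneg hk γ⟩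
  by_contra! hk
  -- For this period the bound `2π + (k - 1/2)T` equals `-2π`.
  have hT : 0 < 4 * Real.pi / (1 / 2 - k) := div_pos (by positivity) (by linarith)
  obtain ⟨γ, hγ, h0, h1, hA⟩ := exists_loop_action_le hT 1
  have := (h _ γ hT hγ (by rw [h0, h1])).trans (hA k)
  rw [← EReal.coe_zero, EReal.coe_le_coe_iff] at this
  have e : (k - 1 / 2) * (4 * Real.pi / (1 / 2 - k)) = -(4 * Real.pi) := by
    have := div_mul_cancel₀ (4 * Real.pi) (show 1 / 2 - k ≠ 0 by linarith)
    linear_combination -this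
  rw [e] at this
  linarith [Real.pi_pos]

theorem cu_eq_half : cu = 1 / 2 := criticalValue_eq_half ⊥

theorem potential_add_le {T C : ℝ} {p q : Heis}
    (h : ∃ γ : ℝ → Heis, IsACCurve T γ ∧ γ 0 = p ∧ γ T = q ∧
      ∀ k, action k T γ ≤ ((C + (k - 1 / 2) * T : ℝ) : EReal)) :
    potential T p q + ((cu * T : ℝ) : EReal) ≤ (C : EReal) := by
  obtain ⟨γ, hγ, h0, h1, hA⟩ := h
  have hle : potential T p q ≤ action 0 T γ := by
    rw [potential]
    exact sInf_le ⟨γ, hγ, h0, h1, rfl⟩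
  have := hle.trans (hA 0)
  calc _ ≤ ((C + (0 - 1 / 2) * T : ℝ) : EReal) + ((cu * T : ℝ) : EReal) := by gcongr
    _ = (C : EReal) := by
      rw [← EReal.coe_add, cu_eq_half]
      congr 1
      ring

theorem le_potential_add {T C : ℝ} {p q : Heis}
    (h : ∀ γ : ℝ → Heis, IsACCurve T γ → γ 0 = p → γ T = q →
      ((C - T / 2 : ℝ) : EReal) ≤ action 0 T γ) :
    (C : EReal) ≤ potential T p q + ((cu * T : ℝ) : EReal) := by
  have : ((C - T / 2 : ℝ) : EReal) ≤ potential T p q := by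
    refine le_sInf ?_
    rintro _ ⟨γ, hγ, h0, h1, rfl⟩
    exact h γ hγ h0 h1
  calc (C : EReal) = ((C - T / 2 : ℝ) : EReal) + ((cu * T : ℝ) : EReal) := by
        rw [← EReal.coe_add, cu_eq_half]
        congr 1
        ring
    _ ≤ _ := by gcongr

theorem peierlsBarrier_self (p : Heis) : peierlsBarrier p p = ((2 * Real.pi : ℝ) : EReal) := by
  refine le_antisymm ?_ ?_
  · calc _ ≤ liminf (fun _ : ℝ => ((2 * Real.pi : ℝ) : EReal)) atTop :=
          liminf_le_liminf ((eventually_gt_atTop 0).mono fun T hT =>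
            potential_add_le (exists_loop_action_le hT p))
      _ = _ := liminf_const _
  · have hlim : Tendsto (fun T : ℝ => ((2 * Real.pi - 2 * Real.pi ^ 2 / T : ℝ) : EReal)) atTop
        (nhds ((2 * Real.pi : ℝ) : EReal)) := by
      refine EReal.tendsto_coe.2 ?_
      simpa using (tendsto_const_nhds (x := 2 * Real.pi)).sub
        ((tendsto_const_nhds (x := 2 * Real.pi ^ 2)).div_atTop tendsto_id)
    rw [← hlim.liminf_eq]
    refine liminf_le_liminf ((eventually_gt_atTop 0).mono fun T hT => ?_)
    exact le_potential_add fun γ hγ h0 h1 => le_action_of_loop hT hγ (h0.trans h1.symm)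

theorem neg_half_mul_le_action {T : ℝ} (hT : 0 ≤ T) {γ : ℝ → Heis} :
    ((0 - T / 2 : ℝ) : EReal) ≤ action 0 T γ := by
  have h : ∫⁻ t in Icc 0 T, ENNReal.ofReal (-(lagrangian (γ t) (velocity γ t) + 0)) ≤
      ENNReal.ofReal (T / 2) := by
    calc _ ≤ ∫⁻ t in Icc 0 T, ENNReal.ofReal (1 / 2) :=
          lintegral_mono fun t => ENNReal.ofReal_le_ofReal
            (by linarith [neg_half_le_lagrangian (γ t) (velocity γ t)])
      _ = ENNReal.ofReal (T / 2) := by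
          rw [setLIntegral_const, Real.volume_Icc, ← ENNReal.ofReal_mul (by norm_num)]
          congr 1
          ring
  rw [action, extIntegral, EReal.coe_sub, EReal.coe_zero]
  refine EReal.sub_le_sub (EReal.coe_ennreal_nonneg _) ?_
  calc _ ≤ ((ENNReal.ofReal (T / 2) : ℝ≥0∞) : EReal) := EReal.coe_ennreal_le_coe_ennreal_iff.2 h
    _ = _ := by rw [EReal.coe_ennreal_ofReal, max_eq_left (by linarith)]

/-- The barrier lies between `0`, since `L + 1/2 ≥ 0`, and the uniform cost of the drifting spirals.
-/
theorem peierlsBarrier_finite (p q : Heis) : ∃ r : ℝ, peierlsBarrier p q = (r : EReal) := by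
  obtain ⟨C, hC⟩ := exists_forall_curve_action_le p q
  have hle : peierlsBarrier p q ≤ (C : EReal) := by
    calc _ ≤ liminf (fun _ : ℝ => (C : EReal)) atTop :=
          liminf_le_liminf ((eventually_ge_atTop 1).mono fun T hT => potential_add_le (hC T hT))
      _ = _ := liminf_const _
  have hge : ((0 : ℝ) : EReal) ≤ peierlsBarrier p q := by
    calc _ = liminf (fun _ : ℝ => ((0 : ℝ) : EReal)) atTop := (liminf_const _).symm
      _ ≤ _ := liminf_le_liminf ((eventually_ge_atTop 0).mono fun T hT =>
            le_potential_add fun γ _ _ _ => neg_half_mul_le_action hT)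
  exact ⟨_, (EReal.coe_toReal (ne_top_of_le_ne_top (EReal.coe_ne_top C) hle)
    (ne_bot_of_le_ne_bot (EReal.coe_ne_bot 0) hge)).symm⟩

end HeisenbergExample

theorem mainTheorem4 :
    HeisenbergExample.cu = 1 / 2 ∧
    HeisenbergExample.ca = 1 / 2 ∧
    (∀ p : HeisenbergExample.Heis,
      HeisenbergExample.peierlsBarrier p p = ((2 * Real.pi : ℝ) : EReal)) ∧
    (∀ p q : HeisenbergExample.Heis, ∃ r : ℝ,
      HeisenbergExample.peierlsBarrier p q = (r : EReal)) ∧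
    HeisenbergExample.projectedAubrySet = ∅ := by
  refine ⟨HeisenbergExample.cu_eq_half, HeisenbergExample.criticalValue_eq_half _,
    HeisenbergExample.peierlsBarrier_self, HeisenbergExample.peierlsBarrier_finite, ?_⟩
  refine Set.eq_empty_of_forall_notMem fun p hp => ?_
  have h : HeisenbergExample.peierlsBarrier p p = 0 := hp
  rw [HeisenbergExample.peierlsBarrier_self, ← EReal.coe_zero, EReal.coe_eq_coe_iff] at h
  linarith [Real.pi_pos]
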